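/- Let $S$ be a $C^1$ surface without boundary and $f\colon S\to S$ a $C^1$ diffeomorphism (for instance, the restriction of a pseudo-Anosov homeomorphism to the complement of the singularities of its invariant foliations). Let $\tau\subset S$ be a generic train track: a finite embedded $C^1$ graph, whose vertices are called switches and whose edges are called branches, such that at each switch exactly three half-branches meet, all tangent to one line, one on one side (the large one) and two on the other side (the small ones). (No condition on the components of $S\setminus\tau$ is needed.) A combinatorial support map for $\tau_1\prec\tau_2$ is a $C^1$ map $S\to S$ homotopic to the identity that maps $\tau_1$ into $\tau_2$ and switches to switches and restricts to isomorphisms between the tangent lines of $\tau_1$ and $\tau_2$. Its transition matrix has as entry in row $b'$ and column $b$ the number of times that the image of the branch $b$ of $\tau_1$ passes over the branch $b'$ of $\tau_2$. A fold $\tau_1\leftharpoonup\tau_2$ is a combinatorial support map for $\tau_1\prec\tau_2$ of the following form. There are a branch $e$ of $\tau_1$ with two distinct end switches, at both of which $e$ is small, and a bijection $c\mapsto c'$ from the branches of $\tau_1$ to those of $\tau_2$. The branch $e$ is mapped to $e'$. At each end of $e$, the other small half-branch at that switch is folded along $e$: each branch $c\ne e$ is mapped to $c'$, preceded (respectively followed)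 by one run along $e'$ if its initial (respectively terminal) half-branch is one of these two. The two folded half-branches leave $e$ both to the left or both to the right, and after the fold $e'$ is a large branch in the corresponding local picture. The three strands that fold to $e'$ are $e$ and the two branches containing the folded half-branches; if these two branches coincide, that branch counts twice. Suppose that $\tau$ is obtained from $f(\tau)$ by a sequence of folds $$f(\tau)=\tau_0\leftharpoonup\tau_1\leftharpoonup\cdots\leftharpoonup\tau_n=\tau ,\qquad n\ge 0,$$ with support maps $\phi_1,\dots,\phi_n$, so that $f(\tau)\prec_\sigma\tau$ with $\sigma=\phi_n\circ\cdots\circ\phi_1$. Let $M$ be the transition matrix of $f(\tau)\prec_\sigma\tau$, with the branches $f(b)$ of $f(\tau)$ indexed by the branches $b$ of $\tau$; thus $M_{b',b}$ is the number of times that $\sigma(f(b))$ passes over $b'$. The cut open flow graph $\Phi^{\mathrm{cut}}$ is the directed multigraph constructed as follows, together with injections $\iota_k$ from the branches of $\tau_k$ into its vertices. Start with one vertex $\iota_0(b)$ for each branch $b$ of $\tau_0$ and no edges. For $k=0,\dots,n-1$, let $\phi_{k+1}$ fold the branch $e$ of $\tau_k$. Add one new vertex, $\iota_{k+1}(e')$,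 and three edges to it, one from the vertex $\iota_k(c)$ for each of the three strands $c$ that fold to $e'$. For every branch $c\ne e$ of $\tau_k$ put $\iota_{k+1}(c')=\iota_k(c)$. Let $\delta_0$ and $\delta_n$ denote the sets of vertices in the images of $\iota_0$ and $\iota_n$. (The vertices correspond to the edges of the cut open layered triangulation built from the folds, and $\delta_0$, $\delta_n$ to the edges of its bottom and top surface triangulations, which are dual to $f(\tau)$ and $\tau$.) Let $G$ be the directed multigraph with vertex set $\delta_0$ that has one edge from $v$ to $v'$ for each directed path in $\Phi^{\mathrm{cut}}$ (paths of length $0$ included) from $v$ to the vertex $\iota_n\circ f^{-1}\circ\iota_0^{-1}(v')$ of $\delta_n$. Index the vertices of $G$ by the branches of $\tau$ through $b\mapsto\iota_0(f(b))$, and let the adjacency matrix of $G$ have as entry in row $b'$ and column $b$ the number of edges from $\iota_0(f(b))$ to $\iota_0(f(b'))$. Then all entries of both matrices are finite, and $M$ equals the adjacency matrix of $G$. -/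

import Mathlib

open Set Filter Topology
open scoped Manifold ContDiff

/-! ### Smooth arcs in a surface -/

/-- A finite system of `C¹` arcs in a surface `S`, parametrized by `[0,1]`
(the values of `curve b` outside `[0,1]` are irrelevant). -/
structure ArcSystem (S : Type*) where
  Branch : Type
  finite_branch : Finite Branch
  curve : Branch → ℝ → S

namespace ArcSystem

variable {S : Type*} (A : ArcSystem S)

/-- The half-branches of the system: `(b, false)` is the initial half of `b` and `(b, true)` its
terminal half. -/
abbrev HalfBranch : Type := A.Branch × Bool

/-- The half-branch `h`, parametrized so that it leaves its switch at time `0`. -/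
def along (h : A.HalfBranch) (t : ℝ) : S :=
  match h with
  | (b, false) => A.curve b t
  | (b, true) => A.curve b (1 - t)

/-- The switch to which a half-branch is incident. -/
def endpoint (h : A.HalfBranch) : S := A.along h 0

/-- The set of switches. -/
def switches : Set S := Set.range A.endpoint

/-- The closed arc traced out by a branch. -/
def arc (b : A.Branch) : Set S := A.curve b '' Icc 0 1

/-- The underlying set. -/
def support : Set S := ⋃ b, A.arc b

variable [TopologicalSpace S] [ChartedSpace (EuclideanSpace ℝ (Fin 2)) S]

/-- The velocity of a branch.  Mathlib's tangent spaces of a surface are all copies of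
`EuclideanSpace ℝ (Fin 2)` (through the preferred chart at the base point), so velocities at one
and the same point of `S` can be compared directly. -/
noncomputable def velocity (b : A.Branch) (t : ℝ) : EuclideanSpace ℝ (Fin 2) :=
  mfderivWithin 𝓘(ℝ, ℝ) (𝓡 2) (A.curve b) (Icc 0 1) t (1 : ℝ)

/-- The direction in which a half-branch leaves its switch. -/
noncomputable def direction (h : A.HalfBranch) : EuclideanSpace ℝ (Fin 2) :=
  match h with
  | (b, false) => A.velocity b 0
  | (b, true) => -A.velocity b 1

/-- The tangent space of the system at a point of its support: the span of all velocities there. -/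
noncomputable def tangentLine (x : S) : Submodule ℝ (TangentSpace (𝓡 2) x) :=
  Submodule.span ℝ {v | ∃ b : A.Branch, ∃ t ∈ Icc (0 : ℝ) 1, A.curve b t = x ∧
    v = (A.velocity b t : EuclideanSpace ℝ (Fin 2))}

end ArcSystem

/-! ### Generic tracks -/

/-- A generic (pre)track in a surface `S`: an embedded finite `C¹` graph, all of whose switches
have three half-branches with one common tangent line, one half-branch on one side and two on the
other side.  A generic train track is a generic pretrack with conditions on the components of its
complement. -/
structure GenericPretrack (S : Type*) [TopologicalSpace S]
    [ChartedSpace (EuclideanSpace ℝ (Fin 2)) S] extends ArcSystem S where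
  contMDiffOn : ∀ b, ContMDiffOn 𝓘(ℝ, ℝ) (𝓡 2) 1 (curve b) (Icc 0 1)
  velocity_ne_zero : ∀ b, ∀ t ∈ Icc (0 : ℝ) 1, toArcSystem.velocity b t ≠ 0
  /-- Branches are embedded and meet each other and themselves at most in switches. -/
  embedded : ∀ b, ∀ t ∈ Ioo (0 : ℝ) 1, ∀ b', ∀ t' ∈ Icc (0 : ℝ) 1,
    curve b t = curve b' t' → b = b' ∧ t = t'
  /-- At each switch there are one half-branch `h₀` on one side (large) and two half-branches
  `h₁`, `h₂` on the other side (small). -/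
  generic : ∀ x ∈ toArcSystem.switches, ∃ h₀ h₁ h₂ : toArcSystem.HalfBranch,
    h₀ ≠ h₁ ∧ h₀ ≠ h₂ ∧ h₁ ≠ h₂ ∧
    (∀ h, toArcSystem.endpoint h = x ↔ h = h₀ ∨ h = h₁ ∨ h = h₂) ∧
    SameRay ℝ (toArcSystem.direction h₁) (toArcSystem.direction h₂) ∧
    SameRay ℝ (toArcSystem.direction h₀) (-toArcSystem.direction h₁)

/-- The arc system `f(A)`. -/
def ArcSystem.map {S : Type*} (A : ArcSystem S) (f : S → S) : ArcSystem S where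
  Branch := A.Branch
  finite_branch := A.finite_branch
  curve b := f ∘ A.curve b

theorem ArcSystem.endpoint_map {S : Type*} (A : ArcSystem S) (f : S → S) (h : A.HalfBranch) :
    (A.map f).endpoint h = f (A.endpoint h) := by
  rcases h with ⟨b, _ | _⟩ <;> rfl

section Surface

variable {S : Type*} [TopologicalSpace S] [ChartedSpace (EuclideanSpace ℝ (Fin 2)) S]

theorem ArcSystem.velocity_map (A : ArcSystem S) (f : S → S)
    (hf : MDifferentiable (𝓡 2) (𝓡 2) f) (b : A.Branch) (t : ℝ) (ht : t ∈ Icc (0 : ℝ) 1)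
    (hb : MDifferentiableWithinAt 𝓘(ℝ, ℝ) (𝓡 2) (A.curve b) (Icc 0 1) t) :
    (A.map f).velocity b t = mfderiv (𝓡 2) (𝓡 2) f (A.curve b t) (A.velocity b t) := by
  have hu : UniqueMDiffWithinAt 𝓘(ℝ, ℝ) (Icc (0 : ℝ) 1) t :=
    (uniqueDiffOn_Icc (by norm_num : (0 : ℝ) < 1) t ht).uniqueMDiffWithinAt
  have := mfderiv_comp_mfderivWithin (I := 𝓘(ℝ, ℝ)) (I' := 𝓡 2) (I'' := 𝓡 2) t
    (hf (A.curve b t)) hb hu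
  unfold ArcSystem.velocity
  exact congrArg (fun L => L (1 : ℝ)) this

theorem GenericPretrack.mdiff (τ : GenericPretrack S) (b : τ.Branch) (t : ℝ)
    (ht : t ∈ Icc (0 : ℝ) 1) :
    MDifferentiableWithinAt 𝓘(ℝ, ℝ) (𝓡 2) (τ.curve b) (Icc 0 1) t :=
  (τ.contMDiffOn b t ht).mdifferentiableWithinAt one_ne_zero

theorem GenericPretrack.direction_map (τ : GenericPretrack S) (f : S → S)
    (hf : MDifferentiable (𝓡 2) (𝓡 2) f) (h : τ.HalfBranch) :
    (τ.toArcSystem.map f).direction h =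
      mfderiv (𝓡 2) (𝓡 2) f (τ.endpoint h) (τ.direction h) := by
  have h0 : (0 : ℝ) ∈ Icc (0 : ℝ) 1 := by simp
  have h1 : (1 : ℝ) ∈ Icc (0 : ℝ) 1 := by simp
  rcases h with ⟨b, _ | _⟩
  · exact τ.toArcSystem.velocity_map f hf b 0 h0 (τ.mdiff b 0 h0)
  · have e : τ.endpoint (b, true) = τ.curve b 1 := by
      simp [ArcSystem.endpoint, ArcSystem.along]
    have := τ.toArcSystem.velocity_map f hf b 1 h1 (τ.mdiff b 1 h1)
    rw [e]
    change -(τ.toArcSystem.map f).velocity b 1 = _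
    rw [this]
    exact (map_neg (mfderiv (𝓡 2) (𝓡 2) f (τ.curve b 1)) (τ.velocity b 1)).symm

/-- The image `f(τ)` of a track under a diffeomorphism. -/
noncomputable def GenericPretrack.map [IsManifold (𝓡 2) 1 S] (τ : GenericPretrack S)
    (f : S ≃ₘ^1⟮𝓡 2, 𝓡 2⟯ S) : GenericPretrack S where
  toArcSystem := τ.toArcSystem.map f
  contMDiffOn b := f.contMDiff.comp_contMDiffOn (τ.contMDiffOn b)
  velocity_ne_zero b t ht := by
    rw [τ.toArcSystem.velocity_map f (f.mdifferentiable one_ne_zero) b t ht (τ.mdiff b t ht)]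
    intro h
    have := (f.mfderivToContinuousLinearEquiv one_ne_zero (τ.curve b t)).map_eq_zero_iff.1 h
    exact τ.velocity_ne_zero b t ht this
  embedded b t ht b' t' ht' h := τ.embedded b t ht b' t' ht' (f.injective h)
  generic x hx := by
    have hd := f.mdifferentiable one_ne_zero
    obtain ⟨h, rfl⟩ := hx
    obtain ⟨h₀, h₁, h₂, h01, h02, h12, hall, hs, ho⟩ := τ.generic _ ⟨h, rfl⟩
    refine ⟨h₀, h₁, h₂, h01, h02, h12, fun k => ?_, ?_, ?_⟩
    · exact ((Eq.congr (τ.toArcSystem.endpoint_map f k) (τ.toArcSystem.endpoint_map f h)).trans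
        f.injective.eq_iff).trans (hall k)
    · rw [τ.direction_map f hd, τ.direction_map f hd, (hall h₁).2 (by simp), (hall h₂).2 (by simp)]
      exact hs.map (mfderiv (𝓡 2) (𝓡 2) f (τ.endpoint h)).toLinearMap
    · rw [τ.direction_map f hd, τ.direction_map f hd, (hall h₀).2 (by simp), (hall h₁).2 (by simp)]
      have := ho.map (mfderiv (𝓡 2) (𝓡 2) f (τ.endpoint h)).toLinearMap
      have hn := map_neg (mfderiv (𝓡 2) (𝓡 2) f (τ.endpoint h)) (τ.direction h₁)
      exact (congrArg (SameRay (M := EuclideanSpace ℝ (Fin 2)) ℝ _) hn).mp this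

/-- The bijection `b ↦ f(b)` from the branches of `τ` to the branches of `f(τ)`. -/
noncomputable def GenericPretrack.mapBranch [IsManifold (𝓡 2) 1 S] (τ : GenericPretrack S)
    (f : S ≃ₘ^1⟮𝓡 2, 𝓡 2⟯ S) : τ.Branch ≃ (τ.map f).Branch := Equiv.refl _

/-! ### Combinatorial support maps and transition matrices -/

/-- A combinatorial support map for `τ₁ ≺ τ₂`.  Tangent spaces of tracks are lines, so the equality
in `tangent` says that the differential restricts to an isomorphism between them. -/
structure SupportMap (τ₁ τ₂ : GenericPretrack S) where
  toFun : S → S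
  contMDiff : ContMDiff (𝓡 2) (𝓡 2) 1 toFun
  homotopic_id :
    (ContinuousMap.mk toFun contMDiff.continuous).Homotopic (ContinuousMap.id S)
  mapsTo : MapsTo toFun τ₁.support τ₂.support
  tangent : ∀ x ∈ τ₁.support,
    (τ₁.tangentLine x).map (mfderiv (𝓡 2) (𝓡 2) toFun x).toLinearMap = τ₂.tangentLine (toFun x)
  mapsTo_switches : MapsTo toFun τ₁.switches τ₂.switches

/-- The identity as a support map. -/
def SupportMap.refl (τ : GenericPretrack S) : SupportMap τ τ where
  toFun := id
  contMDiff := contMDiff_id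
  homotopic_id := ContinuousMap.Homotopic.refl _
  mapsTo _ h := h
  tangent x _ := by
    rw [mfderiv_id]
    exact Submodule.map_id _
  mapsTo_switches _ h := h

/-- Carrying is transitive: the composition `ψ ∘ φ` of support maps. -/
def SupportMap.comp {τ₁ τ₂ τ₃ : GenericPretrack S} (ψ : SupportMap τ₂ τ₃) (φ : SupportMap τ₁ τ₂) :
    SupportMap τ₁ τ₃ where
  toFun := ψ.toFun ∘ φ.toFun
  contMDiff := ψ.contMDiff.comp φ.contMDiff
  homotopic_id := ContinuousMap.Homotopic.comp ψ.homotopic_id φ.homotopic_id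
  mapsTo := ψ.mapsTo.comp φ.mapsTo
  tangent x hx := by
    have := mfderiv_comp x (ψ.contMDiff.mdifferentiable one_ne_zero (φ.toFun x))
      (φ.contMDiff.mdifferentiable one_ne_zero x)
    rw [this]
    refine (Submodule.map_comp _ _ _).trans ?_
    refine (congrArg _ (φ.tangent x hx)).trans ?_
    exact ψ.tangent _ (φ.mapsTo hx)
  mapsTo_switches := ψ.mapsTo_switches.comp φ.mapsTo_switches

/-- On the interval `[s,t]` the curve `γ` runs exactly once along the whole of `c|[0,1]`, in one of
the two directions. -/
def Traverses {X : Type*} (γ : ℝ → X) (s t : ℝ) (c : ℝ → X) : Prop :=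
  s < t ∧ ∃ u : ℝ → ℝ, ContinuousOn u (Icc s t) ∧
    ((StrictMonoOn u (Icc s t) ∧ u s = 0 ∧ u t = 1) ∨
      (StrictAntiOn u (Icc s t) ∧ u s = 1 ∧ u t = 0)) ∧
    ∀ r ∈ Icc s t, γ r = c (u r)

/-- The passages of `σ(b)` over `b'`, each recorded by the interval of time during which it
takes place. -/
def SupportMap.passes {τ₁ τ₂ : GenericPretrack S} (σ : SupportMap τ₁ τ₂) (b : τ₁.Branch)
    (b' : τ₂.Branch) : Set (ℝ × ℝ) :=
  {p | 0 ≤ p.1 ∧ p.2 ≤ 1 ∧ Traverses (σ.toFun ∘ τ₁.curve b) p.1 p.2 (τ₂.curve b')}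

/-- The transition matrix of `τ₁ ≺ τ₂`: its rows are indexed by the branches of `τ₂`, its columns
by the branches of `τ₁`, and the entry at `(b', b)` is the number of times that `σ(b)` passes
over `b'`. -/
noncomputable def SupportMap.transitionMatrix {τ₁ τ₂ : GenericPretrack S}
    (σ : SupportMap τ₁ τ₂) : Matrix τ₂.Branch τ₁.Branch ℕ :=
  Matrix.of fun b' b => (σ.passes b b').ncard

/-! ### Folds -/

/-- The local picture of a track before a fold: the small branch to be folded is
`[-1,1] × {0}`, and the two small half-branches next to it are `{-1} × [0,∞)` and
`{1} × (-∞,0]`. -/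
def foldSource : Set (ℝ × ℝ) :=
  {z | z.2 = 0 ∨ (z.1 = -1 ∧ 0 ≤ z.2) ∨ (z.1 = 1 ∧ z.2 ≤ 0)}

/-- The local picture after a fold: a large branch `[-1,1] × {0}` with two half-branches at either
end. -/
def foldTarget : Set (ℝ × ℝ) :=
  {z | (z.2 = 0 ∧ -1 ≤ z.1 ∧ z.1 ≤ 1) ∨ z.1 = -1 ∨ z.1 = 1}

/-- The fold in the local picture (only its values on `foldSource` matter).  Initial pieces of the
two vertical half-branches are laid over `[-1,1] × {0}`, the left one from left to right and the
right one from right to left; their remainders go to `{1} × [0,∞)` and to `{-1} × (-∞,0]`.  The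
left horizontal ray goes to `{-1} × [0,∞)`, the right one to `{1} × (-∞,0]`. -/
noncomputable def foldModel (z : ℝ × ℝ) : ℝ × ℝ :=
  if z.2 = 0 then
    if z.1 ≤ -1 then (-1, -1 - z.1) else if z.1 ≤ 1 then (z.1, 0) else (1, 1 - z.1)
  else if 0 < z.2 then
    if z.2 ≤ 2 then (z.2 - 1, 0) else (1, z.2 - 2)
  else
    if -2 ≤ z.2 then (1 + z.2, 0) else (-1, z.2 + 2)

/-- A fold `τ₁ ⇀ τ₂`. -/
structure Fold (τ₁ τ₂ : GenericPretrack S) extends SupportMap τ₁ τ₂ where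
  /-- The small branch of `τ₁` being folded. -/
  small : τ₁.Branch
  /-- The half-branches that are folded along the two ends of `small`. -/
  side : Bool → τ₁.HalfBranch
  endpoint_ne : τ₁.endpoint (small, false) ≠ τ₁.endpoint (small, true)
  side_ne : ∀ i, side i ≠ (small, i)
  endpoint_side : ∀ i, τ₁.endpoint (side i) = τ₁.endpoint (small, i)
  /-- There is a cusp between `side i` and the end `i` of `small`; in particular both ends of
  `small` are small half-branches. -/
  side_sameRay : ∀ i, SameRay ℝ (τ₁.direction (side i)) (τ₁.direction (small, i))
  /-- The induced bijection of branches. -/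
  branchEquiv : τ₁.Branch ≃ τ₂.Branch
  /-- The branch `small` is mapped to a single branch. -/
  map_small : Traverses (toFun ∘ τ₁.curve small) 0 1 (τ₂.curve (branchEquiv small))
  /-- Every other branch is mapped to the corresponding branch, preceded or followed by one run
  along the image of `small` for each of its half-branches that is being folded. -/
  map_other : ∀ c, c ≠ small → ∃ s t : ℝ, 0 ≤ s ∧ t ≤ 1 ∧
    Traverses (toFun ∘ τ₁.curve c) s t (τ₂.curve (branchEquiv c)) ∧
    ((c, false) ∈ range side →
      Traverses (toFun ∘ τ₁.curve c) 0 s (τ₂.curve (branchEquiv small))) ∧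
    ((c, false) ∉ range side → s = 0) ∧
    ((c, true) ∈ range side →
      Traverses (toFun ∘ τ₁.curve c) t 1 (τ₂.curve (branchEquiv small))) ∧
    ((c, true) ∉ range side → t = 1)
  /-- In suitable disks of `S` the two tracks and the fold are the ones of the local picture or of
  its mirror image (the embeddings may reverse orientation), which are the left and right folds. -/
  picture : ∃ j₁ j₂ : ℝ × ℝ → S, IsOpenEmbedding j₁ ∧ IsOpenEmbedding j₂ ∧
    j₁ ⁻¹' τ₁.support = foldSource ∧ j₂ ⁻¹' τ₂.support = foldTarget ∧
    j₁ '' {z | z.2 = 0 ∧ -1 ≤ z.1 ∧ z.1 ≤ 1} = τ₁.arc small ∧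
    j₁ (-1, 0) = τ₁.endpoint (small, false) ∧ j₁ (1, 0) = τ₁.endpoint (small, true) ∧
    (∀ᶠ r in 𝓝[>] (0 : ℝ), τ₁.along (side false) r ∈ j₁ '' {z | z.1 = -1 ∧ 0 < z.2}) ∧
    (∀ᶠ r in 𝓝[>] (0 : ℝ), τ₁.along (side true) r ∈ j₁ '' {z | z.1 = 1 ∧ z.2 < 0}) ∧
    ∀ z ∈ foldSource, toFun (j₁ z) = j₂ (foldModel z)

/-- The three strands that fold to the branch `branchEquiv small`: the branch `small` and the two
branches containing the folded half-branches.  (The last two can be one and the same branch, as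
happens in the once-punctured torus; it is then listed twice.) -/
def Fold.strand {τ₁ τ₂ : GenericPretrack S} (φ : Fold τ₁ τ₂) : Fin 3 → τ₁.Branch :=
  ![φ.small, (φ.side false).1, (φ.side true).1]

/-- A finite sequence of folds `τ₀ ⇀ τ₁ ⇀ ⋯ ⇀ τₙ`, `n ≥ 0`. -/
inductive FoldSequence (τ₀ : GenericPretrack S) : GenericPretrack S → Type _ where
  | nil : FoldSequence τ₀ τ₀
  | snoc {τ τ' : GenericPretrack S} (F : FoldSequence τ₀ τ) (φ : Fold τ τ') : FoldSequence τ₀ τ'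

namespace FoldSequence

variable {τ₀ : GenericPretrack S}

/-- The support map `σ = φₙ ∘ ⋯ ∘ φ₁` of a sequence of folds. -/
def supportMap : {τ : GenericPretrack S} → FoldSequence τ₀ τ → SupportMap τ₀ τ
  | _, nil => SupportMap.refl τ₀
  | _, snoc F φ => φ.toSupportMap.comp F.supportMap

/-! ### The cut open flow graph -/

/-- The vertices of the cut open flow graph.  They correspond to the edges of the cut open veering
triangulation: first there is one for each edge of `δ₀`, that is, for each branch of the dual track
`τ₀`; then each fold, that is, each tetrahedron, adds one, which lies on its top edge. -/
def Vertex : {τ : GenericPretrack S} → FoldSequence τ₀ τ → Type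
  | _, nil => τ₀.Branch
  | _, snoc F _ => Option F.Vertex

/-- The vertex in `δ₀` on a given branch of `τ₀`. -/
def bottom : {τ : GenericPretrack S} → (F : FoldSequence τ₀ τ) → τ₀.Branch → F.Vertex
  | _, nil => id
  | _, snoc F _ => fun b => some (F.bottom b)

open Classical in
/-- The vertex in `δₙ` on a given branch of `τₙ`.  A fold keeps all edges of the triangulation
except the bottom edge of its tetrahedron, which is dual to the folded small branch; this edge is
replaced with the top edge, which is dual to the image of that branch. -/
noncomputable def top :
    {τ : GenericPretrack S} → (F : FoldSequence τ₀ τ) → τ.Branch → F.Vertex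
  | _, nil => id
  | _, snoc F φ => fun b =>
      if b = φ.branchEquiv φ.small then none else some (F.top (φ.branchEquiv.symm b))

/-- The edges of the cut open flow graph: each fold adds three edges, from the vertices on the
three strands being folded to the new vertex. -/
def Arrow : {τ : GenericPretrack S} → (F : FoldSequence τ₀ τ) → F.Vertex → F.Vertex → Type
  | _, nil => fun _ _ => Empty
  | _, snoc F φ => fun v w =>
      match v, w with
      | some x, some y => F.Arrow x y
      | some x, none => {i : Fin 3 // F.top (φ.strand i) = x}
      | none, _ => Empty

/-- The cut open flow graph as a directed multigraph. -/
instance {τ : GenericPretrack S} (F : FoldSequence τ₀ τ) : Quiver F.Vertex where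
  Hom := F.Arrow

theorem bottom_injective {τ : GenericPretrack S} (F : FoldSequence τ₀ τ) :
    Function.Injective F.bottom := by
  induction F with
  | nil => exact Function.injective_id
  | snoc F φ ih => exact fun a b h => ih (Option.some.inj h)

/-- The set of vertices of the cut open flow graph that lie in `δ₀`. -/
def bottomVertices {τ : GenericPretrack S} (F : FoldSequence τ₀ τ) : Set F.Vertex :=
  Set.range F.bottom

/-- The bijection between the branches of `τ₀` and the vertices in `δ₀`. -/
noncomputable def bottomEquiv {τ : GenericPretrack S} (F : FoldSequence τ₀ τ) :
    τ₀.Branch ≃ F.bottomVertices :=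
  Equiv.ofInjective F.bottom F.bottom_injective

end FoldSequence

/-! ### The graph `G` -/

section ReturnGraph

variable [IsManifold (𝓡 2) 1 S] {τ : GenericPretrack S} {f : S ≃ₘ^1⟮𝓡 2, 𝓡 2⟯ S}

/-- The change of index `ιₙ ∘ f⁻¹ ∘ ι₀⁻¹` from the vertices in `δ₀` to the vertices in `δₙ`. -/
noncomputable def FoldSequence.reindex (F : FoldSequence (τ.map f) τ) (v : F.bottomVertices) :
    F.Vertex :=
  F.top ((τ.mapBranch f).symm (F.bottomEquiv.symm v))

/-- The vertices of the graph `G`: the vertices of the cut open flow graph that lie in `δ₀`. -/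
def FoldSequence.ReturnGraph (F : FoldSequence (τ.map f) τ) : Type := F.bottomVertices

/-- The graph `G` has an edge from `v` to `v'` for each directed path (possibly of length `0`) in
the cut open flow graph from `v` to the vertex of `δₙ` that corresponds to `v'`. -/
instance (F : FoldSequence (τ.map f) τ) : Quiver F.ReturnGraph where
  Hom v v' := Quiver.Path (v.1 : F.Vertex) (F.reindex v')

/-- The vertices of `G`, indexed by the branches of `τ`: `b ↦ ι₀(f(b))`. -/
noncomputable def FoldSequence.index (F : FoldSequence (τ.map f) τ) : τ.Branch ≃ F.ReturnGraph :=
  (τ.mapBranch f).trans F.bottomEquiv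

end ReturnGraph

end Surface

/-- The adjacency matrix of a directed multigraph, with the same convention as for transition
matrices: the entry in row `w` and column `v` is the number of edges from `v` to `w`. -/
noncomputable def adjacencyMatrix (V : Type*) [Quiver V] : Matrix V V ℕ :=
  Matrix.of fun w v => Nat.card (v ⟶ w)

/-!
Both matrices satisfy the same recursion along the sequence of folds.

*Geometry.*  Under the support map `σ` of a fold sequence, every branch runs through a finite
sequence of full branches of the last track: it has an itinerary (`Itinerary`).  For one fold this
is part of the definition, and itineraries are pulled back along traversals
(`Itinerary.of_traverses`, `Itinerary.bind`), which gives them for fold sequences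
(`FoldSequence.itinerary`).  Since branches are embedded, interior points of branches are neither
switches nor points of other branches; so a passage over a branch cannot overlap a segment of an
itinerary without being equal to it (`GenericPretrack.eq_of_traverses_of_lt`).  Hence the number of
passages over `b'` is the multiplicity of `b'` in the itinerary (`Itinerary.encard_passages`).  A
fold with small branch `e` replaces each occurrence of a branch `c` in the itinerary by `c'`
together with one `e'` for each time that `c ≠ e` is a strand of the fold.  Thus the multiplicity of
`e'` afterwards is the sum of the multiplicities of the three strands, and all other multiplicities
are unchanged (`Fold.count_bind_word_small`, `Fold.count_bind_word_of_ne`).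

*Combinatorics.*  The vertex added by a fold has three incoming edges, from the vertices of the
strands, and no outgoing ones.  So the number of paths that end in it is the sum of the numbers of
paths that end in the vertices of the strands, and the paths between old vertices are unchanged
(`FoldSequence.pathEquiv`, `FoldSequence.card_path`).
-/

/-! ### Traversals -/

namespace Traverses

variable {X Y : Type*} {γ : ℝ → X} {c : ℝ → X} {s t : ℝ}

theorem lt (h : Traverses γ s t c) : s < t := h.1

theorem self (c : ℝ → X) : Traverses c 0 1 c :=
  ⟨one_pos, id, continuousOn_id, Or.inl ⟨strictMonoOn_id, rfl, rfl⟩, fun _ _ => rfl⟩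

/-- At the ends of a traversal the curve is at an end of the traversed arc. -/
theorem exists_eq_left (h : Traverses γ s t c) : ∃ y : ℝ, (y = 0 ∨ y = 1) ∧ γ s = c y := by
  obtain ⟨hst, u, -, hu, he⟩ := h
  refine ⟨u s, ?_, he s (left_mem_Icc.2 hst.le)⟩
  rcases hu with ⟨-, h0, -⟩ | ⟨-, h1, -⟩
  · exact Or.inl h0
  · exact Or.inr h1

theorem exists_eq_right (h : Traverses γ s t c) : ∃ y : ℝ, (y = 0 ∨ y = 1) ∧ γ t = c y := by
  obtain ⟨hst, u, -, hu, he⟩ := h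
  refine ⟨u t, ?_, he t (right_mem_Icc.2 hst.le)⟩
  rcases hu with ⟨-, -, h1⟩ | ⟨-, -, h0⟩
  · exact Or.inr h1
  · exact Or.inl h0

theorem exists_eq_of_mem_Ioo (h : Traverses γ s t c) {r : ℝ} (hr : r ∈ Ioo s t) :
    ∃ y ∈ Ioo (0 : ℝ) 1, γ r = c y := by
  obtain ⟨hst, u, -, hu, he⟩ := h
  have hs := left_mem_Icc.2 hst.le
  have ht := right_mem_Icc.2 hst.le
  have hr' := Ioo_subset_Icc_self hr
  refine ⟨u r, ?_, he r hr'⟩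
  rcases hu with ⟨hm, h0, h1⟩ | ⟨hm, h1, h0⟩
  · exact ⟨h0 ▸ hm hs hr' hr.1, h1 ▸ hm hr' ht hr.2⟩
  · exact ⟨h0 ▸ hm hr' ht hr.2, h1 ▸ hm hs hr' hr.1⟩

/-- Reversing the time of the traversing curve. -/
theorem reverse (h : Traverses γ s t c) : Traverses (fun r => γ (-r)) (-t) (-s) c := by
  obtain ⟨hst, u, hc, hu, he⟩ := h
  have hmaps : MapsTo (fun r : ℝ => -r) (Icc (-t) (-s)) (Icc s t) := fun r hr =>
    ⟨by linarith [hr.2], by linarith [hr.1]⟩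
  refine ⟨neg_lt_neg hst, fun r => u (-r), hc.comp continuousOn_neg hmaps, ?_,
    fun r hr => he _ (hmaps hr)⟩
  simp only [neg_neg]
  rcases hu with ⟨hm, h0, h1⟩ | ⟨hm, h1, h0⟩
  · exact Or.inr ⟨fun a ha b hb hab => hm (hmaps hb) (hmaps ha) (neg_lt_neg hab), h1, h0⟩
  · exact Or.inl ⟨fun a ha b hb hab => hm (hmaps hb) (hmaps ha) (neg_lt_neg hab), h0, h1⟩

/-- Pulling a traversal back along an increasing reparametrization. -/
theorem comp {δ : ℝ → X} {u : ℝ → ℝ} {a b : ℝ} (h : Traverses δ (u a) (u b) c) (hab : a < b)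
    (hc : ContinuousOn u (Icc a b)) (hm : StrictMonoOn u (Icc a b))
    (he : ∀ r ∈ Icc a b, γ r = δ (u r)) : Traverses γ a b c := by
  obtain ⟨-, v, hvc, hv, hve⟩ := h
  have hmaps : MapsTo u (Icc a b) (Icc (u a) (u b)) := fun r hr =>
    ⟨hm.monotoneOn (left_mem_Icc.2 hab.le) hr hr.1, hm.monotoneOn hr (right_mem_Icc.2 hab.le) hr.2⟩
  refine ⟨hab, v ∘ u, hvc.comp hc hmaps, ?_, fun r hr => (he r hr).trans (hve _ (hmaps hr))⟩
  rcases hv with ⟨hvm, h0, h1⟩ | ⟨hvm, h1, h0⟩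
  · exact Or.inl ⟨hvm.comp hm hmaps, h0, h1⟩
  · exact Or.inr ⟨hvm.comp_strictMonoOn hm hmaps, h1, h0⟩

end Traverses

/-! ### Itineraries -/

/-- `Itinerary κ γ s t L` says that on the interval `[s, t]` the curve `γ` is a concatenation of
finitely many traversals of the curves `κ c`.  The multiset `L` contains the index `c` as often as
`κ c` is traversed; the order of the traversals is not recorded. -/
inductive Itinerary {X B : Type*} (κ : B → ℝ → X) (γ : ℝ → X) : ℝ → ℝ → Multiset B → Prop
  | nil (s : ℝ) : Itinerary κ γ s s 0
  | cons {s r t : ℝ} {L : Multiset B} (c : B) (h : Traverses γ s r (κ c))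
      (hL : Itinerary κ γ r t L) : Itinerary κ γ s t (c ::ₘ L)

namespace Itinerary

variable {X B : Type*} {κ : B → ℝ → X} {γ : ℝ → X} {s r t : ℝ} {L L' : Multiset B}

theorem le (h : Itinerary κ γ s t L) : s ≤ t := by
  induction h with
  | nil => exact le_rfl
  | cons c h _ ih => exact h.lt.le.trans ih

theorem single {c : B} (h : Traverses γ s t (κ c)) : Itinerary κ γ s t {c} :=
  .cons c h (.nil t)

theorem append (h : Itinerary κ γ s r L) (h' : Itinerary κ γ r t L') :
    Itinerary κ γ s t (L + L') := by
  induction h with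
  | nil => simpa using h'
  | cons c h _ ih => rw [Multiset.cons_add]; exact .cons c h (ih h')

/-- Reversing time. -/
theorem reverse (h : Itinerary κ γ s t L) :
    Itinerary κ (fun r => γ (-r)) (-t) (-s) L := by
  induction h with
  | nil s => exact .nil _
  | cons c h _ ih =>
    rw [← Multiset.singleton_add, add_comm]
    exact ih.append (single h.reverse)

/-- Pulling an itinerary back along an increasing reparametrization. -/
theorem comp_strictMonoOn {δ : ℝ → X} {p q : ℝ} (h : Itinerary κ δ p q L) {u : ℝ → ℝ} {a b : ℝ}
    (hab : a ≤ b) (hc : ContinuousOn u (Icc a b)) (hm : StrictMonoOn u (Icc a b))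
    (hp : u a = p) (hq : u b = q) (he : ∀ r ∈ Icc a b, γ r = δ (u r)) :
    Itinerary κ γ a b L := by
  induction h generalizing a with
  | nil p =>
    obtain rfl : a = b :=
      hm.injOn (left_mem_Icc.2 hab) (right_mem_Icc.2 hab) (hp.trans hq.symm)
    exact .nil a
  | @cons p m q L c h hL ih =>
    -- The intermediate time is found by the intermediate value theorem.
    obtain ⟨d, hd, hdm⟩ : m ∈ u '' Icc a b :=
      intermediate_value_Icc hab hc ⟨hp ▸ h.lt.le, hq ▸ hL.le⟩
    have had : a < d := by
      refine lt_of_le_of_ne hd.1 ?_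
      rintro rfl
      exact h.lt.ne (hp.symm.trans hdm)
    have h₁ : Icc a d ⊆ Icc a b := Icc_subset_Icc le_rfl hd.2
    have h₂ : Icc d b ⊆ Icc a b := Icc_subset_Icc hd.1 le_rfl
    refine .cons c ?_ (ih hd.2 (hc.mono h₂) (hm.mono h₂) hdm hq fun r hr => he r (h₂ hr))
    refine Traverses.comp ?_ had (hc.mono h₁) (hm.mono h₁) fun r hr => he r (h₁ hr)
    rwa [hp, hdm]

/-- A curve that traverses `c` has the same itinerary as `c` itself, whatever the direction of the
traversal. -/
theorem of_traverses {Y : Type*} {c : ℝ → Y} {γ : ℝ → Y} (φ : Y → X)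
    (h : Traverses γ s t c) (hL : Itinerary κ (φ ∘ c) 0 1 L) : Itinerary κ (φ ∘ γ) s t L := by
  obtain ⟨hst, u, hc, hu, he⟩ := h
  rcases hu with ⟨hm, h0, h1⟩ | ⟨hm, h1, h0⟩
  · exact hL.comp_strictMonoOn hst.le hc hm h0 h1 fun r hr => congrArg φ (he r hr)
  · refine hL.reverse.comp_strictMonoOn (u := fun r => -u r) hst.le hc.neg hm.neg (by rw [h1])
      (by rw [h0]) fun r hr => ?_
    simpa using congrArg φ (he r hr)

/-- If every curve `κ c`, mapped by `φ`, has itinerary `w c`, then the itinerary of a curve mapped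
by `φ` is obtained by substituting `w`. -/
theorem bind {Y B' : Type*} {κ' : B' → ℝ → Y} {w : B → Multiset B'} (φ : X → Y)
    (hw : ∀ c, Itinerary κ' (φ ∘ κ c) 0 1 (w c)) (h : Itinerary κ γ s t L) :
    Itinerary κ' (φ ∘ γ) s t (L.bind w) := by
  induction h with
  | nil s => exact .nil s
  | cons c h _ ih => rw [Multiset.cons_bind]; exact (of_traverses φ h (hw c)).append ih

end Itinerary

section Surface

variable {S : Type*} [TopologicalSpace S] [ChartedSpace (EuclideanSpace ℝ (Fin 2)) S]

/-! ### Passages and itineraries -/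

/-- An interior point of a branch is not an end of a branch. -/
theorem GenericPretrack.curve_ne_of_mem_Ioo (τ : GenericPretrack S) {b b' : τ.Branch} {x y : ℝ}
    (hx : x ∈ Ioo (0 : ℝ) 1) (hy : y = 0 ∨ y = 1) : τ.curve b x ≠ τ.curve b' y := by
  intro h
  have hy' : y ∈ Icc (0 : ℝ) 1 := by rcases hy with rfl | rfl <;> simp
  obtain rfl := (τ.embedded b x hx b' y hy' h).2
  rcases hy with rfl | rfl <;> simp at hx

/-- Two traversals by the same curve cannot overlap without being equal: if one of them begins
during the other, then their time intervals and the traversed branches agree. -/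
theorem GenericPretrack.eq_of_traverses_of_lt (τ : GenericPretrack S) {γ : ℝ → S} {b c : τ.Branch}
    {s r p q : ℝ} (hc : Traverses γ s r (τ.curve c)) (hb : Traverses γ p q (τ.curve b))
    (hsp : s ≤ p) (hpr : p < r) : p = s ∧ q = r ∧ b = c := by
  have disj : ∀ {b c : τ.Branch} {s r : ℝ}, Traverses γ s r (τ.curve c) → ∀ {x : ℝ},
      (∃ y : ℝ, (y = 0 ∨ y = 1) ∧ γ x = τ.curve b y) → x ∉ Ioo s r := by
    rintro b c s r h x ⟨y, hy, hxy⟩ hx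
    obtain ⟨z, hz, hxz⟩ := h.exists_eq_of_mem_Ioo hx
    exact τ.curve_ne_of_mem_Ioo hz hy (hxz.symm.trans hxy)
  obtain rfl : p = s := by
    by_contra hne
    exact disj hc hb.exists_eq_left ⟨lt_of_le_of_ne hsp (Ne.symm hne), hpr⟩
  obtain rfl : q = r := by
    rcases lt_trichotomy q r with h | h | h
    · exact (disj hc hb.exists_eq_right ⟨hb.lt, h⟩).elim
    · exact h
    · exact (disj hb hc.exists_eq_right ⟨hpr, h⟩).elim
  obtain ⟨x, hpx, hxq⟩ := exists_between hpr
  obtain ⟨y, hy, hxy⟩ := hb.exists_eq_of_mem_Ioo ⟨hpx, hxq⟩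
  obtain ⟨z, hz, hxz⟩ := hc.exists_eq_of_mem_Ioo ⟨hpx, hxq⟩
  exact ⟨rfl, rfl, (τ.embedded b y hy c z (Ioo_subset_Icc_self hz) (hxy.symm.trans hxz)).1⟩

open Classical in
/-- The passages of a curve over a branch are counted by its itinerary. -/
theorem Itinerary.encard_passages {τ : GenericPretrack S} {γ : ℝ → S} {s t : ℝ}
    {L : Multiset τ.Branch} (h : Itinerary τ.curve γ s t L) (b : τ.Branch) :
    {p : ℝ × ℝ | s ≤ p.1 ∧ p.2 ≤ t ∧ Traverses γ p.1 p.2 (τ.curve b)}.encard = L.count b := by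
  induction h with
  | nil s =>
    have : {p : ℝ × ℝ | s ≤ p.1 ∧ p.2 ≤ s ∧ Traverses γ p.1 p.2 (τ.curve b)} = ∅ :=
      eq_empty_of_forall_notMem fun p hp => absurd hp.2.2.lt (hp.2.1.trans hp.1).not_gt
    simp [this]
  | @cons s r t L c h hL ih =>
    by_cases hbc : b = c
    · subst hbc
      have : {p : ℝ × ℝ | s ≤ p.1 ∧ p.2 ≤ t ∧ Traverses γ p.1 p.2 (τ.curve b)} =
          insert (s, r) {p : ℝ × ℝ | r ≤ p.1 ∧ p.2 ≤ t ∧ Traverses γ p.1 p.2 (τ.curve b)} := by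
        ext ⟨p, q⟩
        constructor
        · rintro ⟨hp, hq, hT⟩
          rcases le_or_gt r p with hrp | hpr
          · exact Or.inr ⟨hrp, hq, hT⟩
          · obtain ⟨rfl, rfl, -⟩ := τ.eq_of_traverses_of_lt h hT hp hpr
            exact Or.inl rfl
        · rintro (hpq | ⟨hp, hq, hT⟩)
          · obtain ⟨rfl, rfl⟩ := Prod.mk.inj hpq
            exact ⟨le_rfl, hL.le, h⟩
          · exact ⟨h.lt.le.trans hp, hq, hT⟩
      rw [this, encard_insert_of_notMem fun hm => h.lt.not_ge hm.1, ih, Multiset.count_cons_self]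
      norm_cast
    · have : {p : ℝ × ℝ | s ≤ p.1 ∧ p.2 ≤ t ∧ Traverses γ p.1 p.2 (τ.curve b)} =
          {p : ℝ × ℝ | r ≤ p.1 ∧ p.2 ≤ t ∧ Traverses γ p.1 p.2 (τ.curve b)} := by
        ext ⟨p, q⟩
        constructor
        · rintro ⟨hp, hq, hT⟩
          refine ⟨le_of_not_gt fun hpr => ?_, hq, hT⟩
          exact hbc (τ.eq_of_traverses_of_lt h hT hp hpr).2.2
        · rintro ⟨hp, hq, hT⟩
          exact ⟨h.lt.le.trans hp, hq, hT⟩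
      rw [this, ih, Multiset.count_cons_of_ne hbc]

/-! ### Itineraries under folds -/

namespace Fold

variable {τ₁ τ₂ : GenericPretrack S} (φ : Fold τ₁ τ₂)

theorem side_injective : Function.Injective φ.side := by
  have h : φ.side false ≠ φ.side true := fun h => φ.endpoint_ne <| by
    rw [← φ.endpoint_side false, ← φ.endpoint_side true, h]
  rintro (_ | _) (_ | _) hij
  · rfl
  · exact (h hij).elim
  · exact (h hij.symm).elim
  · rfl

/-- The folded half-branches do not belong to the small branch: they would have to be its other
ends, but the ends of the small branch are distinct. -/
theorem side_fst_ne (i : Bool) : (φ.side i).1 ≠ φ.small := by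
  intro h
  obtain ⟨j, hj⟩ : ∃ j, φ.side i = (φ.small, j) := ⟨(φ.side i).2, Prod.ext h rfl⟩
  have hne := φ.side_ne i
  have he := φ.endpoint_side i
  rw [hj] at hne he
  rcases i with _ | _ <;> rcases j with _ | _
  · exact hne rfl
  · exact φ.endpoint_ne he.symm
  · exact φ.endpoint_ne he
  · exact hne rfl

open Classical in
/-- The branches of `τ₂`, with multiplicities, over which the fold maps a branch `c` of `τ₁`. -/
noncomputable def word (c : τ₁.Branch) : Multiset τ₂.Branch :=
  if c = φ.small then {φ.branchEquiv φ.small}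
  else (if (c, false) ∈ range φ.side then {φ.branchEquiv φ.small} else 0) +
    ({φ.branchEquiv c} + if (c, true) ∈ range φ.side then {φ.branchEquiv φ.small} else 0)

theorem itinerary_word (c : τ₁.Branch) :
    Itinerary τ₂.curve (φ.toFun ∘ τ₁.curve c) 0 1 (φ.word c) := by
  classical
  unfold word
  split_ifs with hc h₀ h₁ h₁
  · subst hc
    exact .single φ.map_small
  all_goals obtain ⟨s, t, -, -, hT, hs, hs', ht, ht'⟩ := φ.map_other c hc
  · exact (Itinerary.single (hs h₀)).append ((Itinerary.single hT).append (.single (ht h₁)))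
  · obtain rfl := ht' h₁
    exact (Itinerary.single (hs h₀)).append ((Itinerary.single hT).append (.nil _))
  · obtain rfl := hs' h₀
    exact (Itinerary.nil _).append ((Itinerary.single hT).append (.single (ht h₁)))
  · obtain rfl := hs' h₀
    obtain rfl := ht' h₁
    exact (Itinerary.nil _).append ((Itinerary.single hT).append (.nil _))

open Classical in
/-- The fold maps a branch `c` over the image of the small branch as often as `c` is a strand. -/
theorem count_word_small (c : τ₁.Branch) :
    (φ.word c).count (φ.branchEquiv φ.small) = ∑ i, if φ.strand i = c then 1 else 0 := by
  have hinj := φ.side_injective.ne (show false ≠ true by simp)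
  have h0 := φ.side_fst_ne false
  have h1 := φ.side_fst_ne true
  rw [Fin.sum_univ_three]
  simp only [strand, Matrix.cons_val_zero, Matrix.cons_val_one, Matrix.cons_val]
  by_cases hc : c = φ.small
  · simp [word, hc, h0, h1]
  · have hc' : φ.small ≠ c := fun h => hc h.symm
    have hc'' : φ.branchEquiv φ.small ≠ φ.branchEquiv c := φ.branchEquiv.injective.ne hc'
    simp only [word, hc, hc', if_false, Multiset.count_add, Multiset.count_singleton, hc'',
      mem_range, Bool.exists_bool, apply_ite (Multiset.count (φ.branchEquiv φ.small)),
      Multiset.count_zero, if_true]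
    have key : ∀ x y : τ₁.HalfBranch, x ≠ y →
        (if x = (c, false) ∨ y = (c, false) then 1 else 0) +
          (0 + if x = (c, true) ∨ y = (c, true) then 1 else 0) =
        (0 + if x.1 = c then 1 else 0) + if y.1 = c then 1 else 0 := by
      rintro ⟨x, i⟩ ⟨y, j⟩ hxy
      by_cases hx : x = c <;> by_cases hy : y = c <;> rcases i with _ | _ <;>
        rcases j with _ | _ <;> simp_all
    convert key _ _ hinj
    all_goals exact if_congr Iff.rfl rfl rfl

open Classical in
theorem count_word_of_ne {b' : τ₂.Branch} (hb' : b' ≠ φ.branchEquiv φ.small) (c : τ₁.Branch) :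
    (φ.word c).count b' = if φ.branchEquiv.symm b' = c then 1 else 0 := by
  have hiff : φ.branchEquiv.symm b' = c ↔ b' = φ.branchEquiv c := Equiv.symm_apply_eq _
  by_cases hc : c = φ.small
  · subst hc
    simp [word, hiff, hb']
  · simp only [word, hc, hiff, hb', if_false, Multiset.count_add, Multiset.count_singleton,
      apply_ite (Multiset.count b'), Multiset.count_zero, ite_self, zero_add, add_zero]

open Classical in
theorem count_bind_word_small (L : Multiset τ₁.Branch) :
    (L.bind φ.word).count (φ.branchEquiv φ.small) = ∑ i, L.count (φ.strand i) := by
  induction L using Multiset.induction with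
  | empty => simp
  | cons c L ih =>
    simp only [Multiset.cons_bind, Multiset.count_add, ih, count_word_small, Multiset.count_cons,
      Finset.sum_add_distrib]
    exact add_comm _ _

open Classical in
theorem count_bind_word_of_ne (L : Multiset τ₁.Branch) {b' : τ₂.Branch}
    (hb' : b' ≠ φ.branchEquiv φ.small) :
    (L.bind φ.word).count b' = L.count (φ.branchEquiv.symm b') := by
  induction L using Multiset.induction with
  | empty => simp
  | cons c L ih =>
    simp only [Multiset.cons_bind, Multiset.count_add, ih, φ.count_word_of_ne hb',
      Multiset.count_cons]
    exact add_comm _ _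

end Fold

namespace FoldSequence

variable {τ₀ : GenericPretrack S}

/-- The branches of the last track, with multiplicities, over which the support map of a fold
sequence maps a branch of the first one. -/
noncomputable def word : {τ : GenericPretrack S} → FoldSequence τ₀ τ → τ₀.Branch →
    Multiset τ.Branch
  | _, nil => fun b => {b}
  | _, snoc F φ => fun b => (F.word b).bind φ.word

theorem itinerary {τ : GenericPretrack S} (F : FoldSequence τ₀ τ) (b : τ₀.Branch) :
    Itinerary τ.curve (F.supportMap.toFun ∘ τ₀.curve b) 0 1 (F.word b) := by
  induction F with
  | nil => exact .single (Traverses.self _)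
  | snoc F φ ih => exact ih.bind φ.toFun φ.itinerary_word

open Classical in
theorem encard_passes {τ : GenericPretrack S} (F : FoldSequence τ₀ τ) (b : τ₀.Branch)
    (b' : τ.Branch) : (F.supportMap.passes b b').encard = (F.word b).count b' :=
  (F.itinerary b).encard_passages b'

/-! ### Paths in the cut open flow graph -/

section Paths

variable {τ τ' : GenericPretrack S} (F : FoldSequence τ₀ τ) (φ : Fold τ τ')

/-- The type of paths from an old vertex `x` to a vertex `w` after a further fold, expressed by
paths before the fold. -/
def PathBefore (x : F.Vertex) : Option F.Vertex → Type
  | some y => Quiver.Path x y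
  | none => Σ i : Fin 3, Quiver.Path x (F.top (φ.strand i))

/-- A path after a further fold stays among the old vertices, except possibly for its last edge,
which then comes from a strand. -/
noncomputable def pathBefore (x : F.Vertex) : {w : (F.snoc φ).Vertex} →
    Quiver.Path (V := (F.snoc φ).Vertex) (some x) w → PathBefore F φ x w
  | _, .nil => Quiver.Path.nil (V := F.Vertex)
  | w, Quiver.Path.cons (V := (F.snoc φ).Vertex) (b := v) p e =>
    match v, w, pathBefore x p, e with
    | some _, some _, q, e => Quiver.Path.cons (V := F.Vertex) q e
    | some _, none, q, e => ⟨e.1, Quiver.Path.cast (U := F.Vertex) rfl e.2.symm q⟩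
    | none, _, _, e => Empty.elim e

/-- The inclusion of the old graph into the graph after a further fold. -/
def inclusion : F.Vertex ⥤q (F.snoc φ).Vertex where
  obj := some
  map e := e

/-- The path after a further fold that corresponds to a path before it. -/
noncomputable def pathAfter (x : F.Vertex) : (w : Option F.Vertex) → PathBefore F φ x w →
    Quiver.Path (V := (F.snoc φ).Vertex) (some x) w
  | some _, q => (inclusion F φ).mapPath q
  | none, ⟨i, q⟩ =>
    Quiver.Path.cons (V := (F.snoc φ).Vertex)
      (b := (some (F.top (φ.strand i)) : Option F.Vertex)) (c := (none : Option F.Vertex))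
      ((inclusion F φ).mapPath q) ⟨i, rfl⟩

theorem pathAfter_pathBefore (x : F.Vertex) {w : (F.snoc φ).Vertex}
    (p : Quiver.Path (V := (F.snoc φ).Vertex) (some x) w) :
    pathAfter F φ x w (pathBefore F φ x p) = p := by
  induction p with
  | nil => rfl
  | @cons v w p e ih =>
    rcases v with _ | v
    · exact Empty.elim e
    · rcases w with _ | w
      · obtain ⟨i, rfl⟩ := e
        exact congrArg (fun q => Quiver.Path.cons (V := (F.snoc φ).Vertex)
          (b := (some (F.top (φ.strand i)) : Option F.Vertex)) (c := (none : Option F.Vertex))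
          q ⟨i, rfl⟩) ih
      · exact congrArg (fun q => Quiver.Path.cons (V := (F.snoc φ).Vertex) (c := some w) q e) ih

theorem pathBefore_mapPath {x y : F.Vertex} (q : Quiver.Path x y) :
    pathBefore F φ x ((inclusion F φ).mapPath q) = q := by
  induction q with
  | nil => rfl
  | cons q e ih => exact congrArg (fun q => Quiver.Path.cons (V := F.Vertex) q e) ih

theorem pathBefore_pathAfter (x : F.Vertex) (w : Option F.Vertex) (q : PathBefore F φ x w) :
    pathBefore F φ x (pathAfter F φ x w q) = q := by
  rcases w with _ | y
  · obtain ⟨i, q⟩ := q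
    exact congrArg (Sigma.mk i) (pathBefore_mapPath F φ q)
  · exact pathBefore_mapPath F φ q

/-- Paths from an old vertex after a further fold correspond to paths before it. -/
noncomputable def pathEquiv (x : F.Vertex) (w : Option F.Vertex) :
    Quiver.Path (V := (F.snoc φ).Vertex) (some x) w ≃ PathBefore F φ x w where
  toFun := pathBefore F φ x
  invFun := pathAfter F φ x w
  left_inv := pathAfter_pathBefore F φ x
  right_inv := pathBefore_pathAfter F φ x w

end Paths

open Classical in
/-- Paths in the cut open flow graph are counted by the itineraries of the branches. -/
theorem card_path {τ : GenericPretrack S} (F : FoldSequence τ₀ τ) (b : τ₀.Branch)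
    (b' : τ.Branch) : Finite (Quiver.Path (F.bottom b) (F.top b')) ∧
      Nat.card (Quiver.Path (F.bottom b) (F.top b')) = (F.word b).count b' := by
  induction F with
  | nil =>
    have eq_nil : ∀ p : Quiver.Path (V := (nil : FoldSequence τ₀ τ₀).Vertex) b b',
        ∃ h : b = b', p = Quiver.Path.cast (U := (nil : FoldSequence τ₀ τ₀).Vertex) rfl h .nil := by
      intro p
      cases p with
      | nil => exact ⟨rfl, rfl⟩
      | cons _ e => exact Empty.elim e
    change Finite (Quiver.Path (V := (nil : FoldSequence τ₀ τ₀).Vertex) b b') ∧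
      Nat.card (Quiver.Path (V := (nil : FoldSequence τ₀ τ₀).Vertex) b b') =
        Multiset.count b' {b}
    have : Subsingleton (Quiver.Path (V := (nil : FoldSequence τ₀ τ₀).Vertex) b b') :=
      ⟨fun p q => (eq_nil p).2.trans (eq_nil q).2.symm⟩
    refine ⟨inferInstance, ?_⟩
    by_cases h : b = b'
    · subst h
      have : Nonempty (Quiver.Path (V := (nil : FoldSequence τ₀ τ₀).Vertex) b b) := ⟨.nil⟩
      rw [Multiset.count_singleton_self]
      exact Nat.card_unique
    · have : IsEmpty (Quiver.Path (V := (nil : FoldSequence τ₀ τ₀).Vertex) b b') :=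
        ⟨fun p => h (eq_nil p).1⟩
      rw [Multiset.count_singleton, if_neg fun h' => h h'.symm]
      exact Nat.card_of_isEmpty
  | @snoc τ τ' F φ ih =>
    have e := pathEquiv F φ (F.bottom b) ((F.snoc φ).top b')
    suffices h : Finite (PathBefore F φ (F.bottom b) ((F.snoc φ).top b')) ∧
        Nat.card (PathBefore F φ (F.bottom b) ((F.snoc φ).top b')) =
          ((F.word b).bind φ.word).count b' by
      exact ⟨(Equiv.finite_iff e).2 h.1, (Nat.card_congr e).trans h.2⟩
    by_cases hb' : b' = φ.branchEquiv φ.small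
    · have ht : (F.snoc φ).top b' = none := if_pos hb'
      have := fun i => (ih (φ.strand i)).1
      rw [ht, hb', φ.count_bind_word_small]
      change Finite (Σ i : Fin 3, Quiver.Path (F.bottom b) (F.top (φ.strand i))) ∧
        Nat.card (Σ i : Fin 3, Quiver.Path (F.bottom b) (F.top (φ.strand i))) = _
      exact ⟨inferInstance,
        Nat.card_sigma.trans (Finset.sum_congr rfl fun i _ => (ih (φ.strand i)).2)⟩
    · have ht : (F.snoc φ).top b' = some (F.top (φ.branchEquiv.symm b')) := if_neg hb'
      rw [ht, φ.count_bind_word_of_ne _ hb']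
      exact ih _

end FoldSequence

end Surface

theorem mainTheorem4 {S : Type*} [TopologicalSpace S] [T2Space S] [SecondCountableTopology S]
    [ChartedSpace (EuclideanSpace ℝ (Fin 2)) S] [IsManifold (𝓡 2) 1 S]
    (f : S ≃ₘ^1⟮𝓡 2, 𝓡 2⟯ S) (τ : GenericPretrack S) (F : FoldSequence (τ.map f) τ) :
    (∀ b b', (F.supportMap.passes b b').Finite) ∧
    (∀ v v' : F.ReturnGraph, Finite (v ⟶ v')) ∧
    F.supportMap.transitionMatrix.submatrix id (τ.mapBranch f) =
      (adjacencyMatrix F.ReturnGraph).submatrix F.index F.index := by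
  classical
  refine ⟨fun b b' => ?_, ?_, ?_⟩
  · exact finite_of_encard_eq_coe (F.encard_passes b b')
  · rintro ⟨_, b, rfl⟩ v'
    exact (F.card_path b _).1
  · ext b' b
    have hr : F.reindex (F.index b') = F.top b' := by
      change F.top ((τ.mapBranch f).symm
        (F.bottomEquiv.symm (F.bottomEquiv (τ.mapBranch f b')))) = _
      rw [Equiv.symm_apply_apply, Equiv.symm_apply_apply]
    change (F.supportMap.passes (τ.mapBranch f b) b').ncard =
      Nat.card (Quiver.Path (F.bottom (τ.mapBranch f b)) (F.reindex (F.index b')))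
    rw [hr, (F.card_path _ b').2, ncard, F.encard_passes]
    rfl
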